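/- Let $p\in\mathbb N$, and for $j=1,\dots,p$ let $\mathcal T_j\subset\mathbb R$ be a compact interval of positive length, or more generally a disjoint union of finitely many such intervals. Let $H_j=L^2(\mathcal T_j)$ be the real Hilbert space with $\langle x,y\rangle_{H_j}=\int_{\mathcal T_j}x(t)y(t)\,dt$, let $$W_j^2=\{x : x \text{ and } x' \text{ are absolutely continuous on } \mathcal T_j \text{ and } x''\in H_j\}\subset H_j,$$ and let $\mathbb H=H_1\times\cdots\times H_p$, with $\langle \boldsymbol x,\boldsymbol y\rangle_{\mathbb H}=\sum_{j=1}^p\langle x_j,y_j\rangle_{H_j}$, and $\mathbb W^2=W_1^2\times\cdots\times W_p^2$. Let $\alpha_1,\dots,\alpha_p>0$ and, for $\boldsymbol x,\boldsymbol y\in\mathbb W^2$, put $$\langle \boldsymbol x,\boldsymbol y\rangle_{\boldsymbol\alpha}=\sum_{j=1}^p\bigl(\langle x_j,y_j\rangle_{H_j}+\alpha_j\langle x_j'',y_j''\rangle_{H_j}\bigr),\qquad \|\boldsymbol x\|_{\boldsymbol\alpha}=\sqrt{\langle \boldsymbol x,\boldsymbol x\rangle_{\boldsymbol\alpha}}.$$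 Let $\mathcal R_j:x\mapsto x''$ be the second-derivative operator in $H_j$ with domain $W_j^2$, let $\mathcal Q_j=\mathcal R_j^*\mathcal R_j$ (the fourth-derivative operator), let $\mathcal S_{\alpha_j}=(\mathcal I+\alpha_j\mathcal Q_j)^{-1/2}$ be the nonnegative self-adjoint square root of $(\mathcal I+\alpha_j\mathcal Q_j)^{-1}$, and let $\mathcal S_{\boldsymbol\alpha}=\operatorname{diag}(\mathcal S_{\alpha_1},\dots,\mathcal S_{\alpha_p})$ on $\mathbb H$. Then each $\mathcal S_{\alpha_j}$ exists, and $\mathcal S_{\boldsymbol\alpha}$ is an everywhere defined bounded linear self-adjoint operator on $\mathbb H$ with operator norm at most $1$. It is injective, and its range, which is the domain of $\mathcal S_{\boldsymbol\alpha}^{-1}$, is $\mathbb W^2$. Moreover, for all $\boldsymbol x,\boldsymbol y\in\mathbb W^2$, $$\langle \mathcal S_{\boldsymbol\alpha}^{-1}\boldsymbol x,\mathcal S_{\boldsymbol\alpha}^{-1}\boldsymbol y\rangle_{\mathbb H}=\langle \boldsymbol x,\boldsymbol y\rangle_{\boldsymbol\alpha},\qquad\text{and in particular}\qquad \|\mathcal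 S_{\boldsymbol\alpha}^{-1}\boldsymbol x\|_{\mathbb H}=\|\boldsymbol x\|_{\boldsymbol\alpha}.$$ -/

import Mathlib

open MeasureTheory

noncomputable section

/-! ### The function spaces -/

/-- `T` is a disjoint union of finitely many compact intervals of positive length. -/
def IsIntervalUnion (T : Set ℝ) : Prop :=
  ∃ (m : ℕ) (a b : Fin m → ℝ), (∀ i, a i < b i) ∧
    Pairwise (fun i k => Disjoint (Set.Icc (a i) (b i)) (Set.Icc (a k) (b k))) ∧
    T = ⋃ i, Set.Icc (a i) (b i)

/-- The real Hilbert space `L²(T)` with respect to Lebesgue measure on `T`. -/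
abbrev L2 (T : Set ℝ) : Type := Lp ℝ 2 ((volume : Measure ℝ).restrict T)

/-- Absolute continuity on `T`: on every compact interval contained in `T`. When `T` is a finite
disjoint union of compact intervals this is the usual `ε`-`δ` notion, because distinct intervals
are a positive distance apart. -/
def AbsContOn (f : ℝ → ℝ) (T : Set ℝ) : Prop :=
  ∀ a b : ℝ, Set.uIcc a b ⊆ T → AbsolutelyContinuousOnInterval f a b

/-- `x ∈ L²(T)` has a representative `f` with derivative `g` everywhere on `T` (one-sided at
endpoints), `f` and `g` are absolutely continuous on `T`, and the derivative of `g`, which exists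
almost everywhere, is the element `y` of `L²(T)`. That is, `x ∈ W²(T)` and `x'' = y`. -/
def IsSecondDeriv (T : Set ℝ) (x y : L2 T) : Prop :=
  ∃ f g : ℝ → ℝ,
    (x =ᵐ[volume.restrict T] f) ∧
    (∀ t ∈ T, HasDerivWithinAt f (g t) T t) ∧
    AbsContOn f T ∧ AbsContOn g T ∧
    ∀ᵐ t ∂(volume.restrict T), HasDerivWithinAt g (y t) T t

/-- The graph of the second-derivative operator. -/
def secondDerivGraph (T : Set ℝ) : Submodule ℝ (L2 T × L2 T) where
  carrier := {q | IsSecondDeriv T q.1 q.2}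
  zero_mem' := by
    refine ⟨0, 0, Lp.coeFn_zero _ _ _, fun t _ => hasDerivWithinAt_const _ _ _, ?_, ?_, ?_⟩
    · exact fun a b _ => (LipschitzWith.const (0 : ℝ)).lipschitzOnWith.absolutelyContinuousOnInterval
    · exact fun a b _ => (LipschitzWith.const (0 : ℝ)).lipschitzOnWith.absolutelyContinuousOnInterval
    · filter_upwards [Lp.coeFn_zero ℝ 2 (volume.restrict T)] with t ht
      show HasDerivWithinAt 0 ((0 : L2 T) t) T t
      rw [ht]
      exact hasDerivWithinAt_const _ _ _
  add_mem' := by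
    rintro ⟨x, y⟩ ⟨x', y'⟩ ⟨f, g, h1, h2, h3, h4, h5⟩ ⟨f', g', k1, k2, k3, k4, k5⟩
    refine ⟨f + f', g + g', ?_, fun t ht => (h2 t ht).add (k2 t ht),
      fun a b hab => (h3 a b hab).add (k3 a b hab),
      fun a b hab => (h4 a b hab).add (k4 a b hab), ?_⟩
    · exact (Lp.coeFn_add x x').trans (h1.add k1)
    · filter_upwards [h5, k5, Lp.coeFn_add y y'] with t ht kt e
      show HasDerivWithinAt (g + g') ((y + y' : L2 T) t) T t
      rw [e]
      exact ht.add kt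
  smul_mem' := by
    rintro c ⟨x, y⟩ ⟨f, g, h1, h2, h3, h4, h5⟩
    refine ⟨c • f, c • g, ?_, fun t ht => (h2 t ht).const_smul c,
      fun a b hab => (h3 a b hab).const_smul c,
      fun a b hab => (h4 a b hab).const_smul c, ?_⟩
    · exact (Lp.coeFn_smul c x).trans (h1.const_smul c)
    · filter_upwards [h5, Lp.coeFn_smul c y] with t ht e
      show HasDerivWithinAt (c • g) ((c • y : L2 T) t) T t
      rw [e]
      exact ht.const_smul c

/-- The second-derivative operator `R : x ↦ x''`, an unbounded operator in `L²(T)` with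
domain `W²(T)`. -/
def secondDeriv (T : Set ℝ) : L2 T →ₗ.[ℝ] L2 T := (secondDerivGraph T).toLinearPMap

/-- The Sobolev space `W²(T)`, as a subspace of `L²(T)`. -/
abbrev W2 (T : Set ℝ) : Submodule ℝ (L2 T) := (secondDeriv T).domain

theorem mem_W2_iff (T : Set ℝ) (x : L2 T) : x ∈ W2 T ↔ ∃ y : L2 T, IsSecondDeriv T x y := by
  constructor
  · rintro ⟨⟨x', y⟩, h, rfl⟩
    exact ⟨y, h⟩
  · rintro ⟨y, h⟩
    exact ⟨⟨x, y⟩, h, rfl⟩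

/-- The second derivative is unique. -/
theorem IsSecondDeriv.eq_zero {T : Set ℝ} (hT : IsIntervalUnion T) {x y : L2 T}
    (h : IsSecondDeriv T x y) (hx : x = 0) : y = 0 := by
  obtain ⟨m, a, b, hab, -, hTe⟩ := hT
  obtain ⟨f, g, hxf, hfg, -, -, hgy⟩ := h
  have hsub : ∀ i, Set.Icc (a i) (b i) ⊆ T := fun i => by
    rw [hTe]; exact Set.subset_iUnion (fun i => Set.Icc (a i) (b i)) i
  have hTm : MeasurableSet T := by
    rw [hTe]; exact MeasurableSet.iUnion fun i => measurableSet_Icc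
  have huniq : ∀ t ∈ T, UniqueDiffWithinAt ℝ T t := by
    intro t ht
    rw [hTe, Set.mem_iUnion] at ht
    obtain ⟨i, hi⟩ := ht
    exact (uniqueDiffOn_Icc (hab i) t hi).mono (hsub i)
  have hf0 : ∀ t ∈ T, f t = 0 := by
    have hae : ∀ᵐ t ∂(volume.restrict T), f t = 0 := by
      subst hx
      filter_upwards [hxf, Lp.coeFn_zero ℝ 2 (volume.restrict T)] with t h1 h2
      rw [← h1, h2]; rfl
    intro t ht
    rw [hTe, Set.mem_iUnion] at ht
    obtain ⟨i, hi⟩ := ht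
    have hae' : f =ᵐ[volume.restrict (Set.Icc (a i) (b i))] (fun _ => (0 : ℝ)) :=
      ae_mono (Measure.restrict_mono (hsub i) le_rfl) hae
    have hc : ContinuousOn f (Set.Icc (a i) (b i)) := fun s hs =>
      ((hfg s (hsub i hs)).continuousWithinAt).mono (hsub i)
    exact Measure.eqOn_Icc_of_ae_eq volume (hab i).ne hae' hc continuousOn_const hi
  have hg0 : ∀ t ∈ T, g t = 0 := by
    intro t ht
    refine (huniq t ht).eq_deriv T (hfg t ht) ?_
    exact (hasDerivWithinAt_const t T (0 : ℝ)).congr (fun s hs => hf0 s hs) (hf0 t ht)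
  refine Lp.ext ?_
  filter_upwards [hgy, ae_restrict_mem hTm, Lp.coeFn_zero ℝ 2 (volume.restrict T)]
    with t h1 ht h2
  rw [h2]
  refine (huniq t ht).eq_deriv T h1 ?_
  exact (hasDerivWithinAt_const t T (0 : ℝ)).congr (fun s hs => hg0 s hs) (hg0 t ht)

/-- `secondDeriv T` does have the intended graph. -/
theorem secondDeriv_graph {T : Set ℝ} (hT : IsIntervalUnion T) (x y : L2 T) :
    (x, y) ∈ (secondDeriv T).graph ↔ IsSecondDeriv T x y := by
  rw [secondDeriv, Submodule.toLinearPMap_graph_eq]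
  · exact Iff.rfl
  · exact fun q hq h0 => IsSecondDeriv.eq_zero hT hq h0

/-! ### Unbounded operators in a Hilbert space -/

section Operators

variable {E : Type*} [NormedAddCommGroup E] [InnerProductSpace ℝ E]

/-- The product `B A` of unbounded operators, with domain `{x ∈ D(A) : A x ∈ D(B)}`. -/
def opComp (B A : E →ₗ.[ℝ] E) : E →ₗ.[ℝ] E :=
  B.comp (A.domRestrict ((B.domain.comap A.toFun).map A.domain.subtype)) (by
    rintro ⟨x, ⟨z, hz, hzx⟩, hx⟩
    have h : A ⟨x, hx⟩ ∈ B.domain := by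
      have e : z = ⟨x, hx⟩ := Subtype.ext hzx
      rw [← e]
      exact hz
    exact h)

/-- `B` is a nonnegative self-adjoint operator with `B² = A` (domains included), that is,
`B = A^{1/2}`. -/
def IsPosSqrt [CompleteSpace E] (A B : E →ₗ.[ℝ] E) : Prop :=
  IsSelfAdjoint B ∧ (∀ x : B.domain, 0 ≤ inner ℝ (B x) (x : E)) ∧ opComp B B = A

open scoped Classical in
/-- The square root `A^{1/2}` of a nonnegative self-adjoint operator `A`
(and the trivial operator with domain `{0}` if there is none). -/
def posSqrt [CompleteSpace E] (A : E →ₗ.[ℝ] E) : E →ₗ.[ℝ] E :=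
  if h : ∃ B, IsPosSqrt A B then h.choose else ⊥

end Operators

/-- The diagonal operator `diag(A₁, …, A_p)` in the Hilbert space `H₁ × ⋯ × H_p`, with domain
`D(A₁) × ⋯ × D(A_p)`. -/
def diagOp {ι : Type*} [Fintype ι] {H : ι → Type*} [∀ j, NormedAddCommGroup (H j)]
    [∀ j, InnerProductSpace ℝ (H j)] (A : ∀ j, H j →ₗ.[ℝ] H j) :
    PiLp 2 H →ₗ.[ℝ] PiLp 2 H where
  domain :=
    { carrier := {x | ∀ j, x j ∈ (A j).domain}
      zero_mem' := fun j => (A j).domain.zero_mem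
      add_mem' := fun hx hy j => (A j).domain.add_mem (hx j) (hy j)
      smul_mem' := fun c _ hx j => (A j).domain.smul_mem c (hx j) }
  toFun :=
    { toFun := fun x => WithLp.toLp 2 fun j => A j ⟨(x : PiLp 2 H) j, x.2 j⟩
      map_add' := by
        intro x y
        ext j
        exact (A j).map_add ⟨(x : PiLp 2 H) j, x.2 j⟩ ⟨(y : PiLp 2 H) j, y.2 j⟩
      map_smul' := by
        intro c x
        ext j
        exact (A j).map_smul c ⟨(x : PiLp 2 H) j, x.2 j⟩ }

/-! ### Half-smoothing -/

/-- The fourth-derivative operator `Q = R* R`, where `R*` is the Hilbert space adjoint of `R`. -/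
def fourthDeriv (T : Set ℝ) : L2 T →ₗ.[ℝ] L2 T :=
  opComp (secondDeriv T).adjoint (secondDeriv T)

/-- The resolvent `(I + α Q)⁻¹`. -/
def smoothing (T : Set ℝ) (α : ℝ) : L2 T →ₗ.[ℝ] L2 T :=
  ((LinearMap.id : L2 T →ₗ[ℝ] L2 T) +ᵥ (α • fourthDeriv T)).inverse

/-- The half-smoothing operator `(I + α Q)^{-1/2}`. -/
def halfSmoothing (T : Set ℝ) (α : ℝ) : L2 T →ₗ.[ℝ] L2 T := posSqrt (smoothing T α)

variable {p : ℕ}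

/-- The Hilbert space `ℍ = L²(T₁) × ⋯ × L²(T_p)`, with inner product `∑ⱼ ⟨xⱼ, yⱼ⟩`. -/
abbrev ProdL2 (T : Fin p → Set ℝ) : Type := PiLp 2 fun j => L2 (T j)

/-- The product Sobolev space `𝕎² = W²(T₁) × ⋯ × W²(T_p)`, as a subspace of `ℍ`. -/
def ProdW2 (T : Fin p → Set ℝ) : Submodule ℝ (ProdL2 T) where
  carrier := {x | ∀ j, x j ∈ W2 (T j)}
  zero_mem' := fun j => (W2 (T j)).zero_mem
  add_mem' := fun hx hy j => (W2 (T j)).add_mem (hx j) (hy j)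
  smul_mem' := fun c _ hx j => (W2 (T j)).smul_mem c (hx j)

/-- `⟨x, y⟩_α = ∑ⱼ (⟨xⱼ, yⱼ⟩ + αⱼ ⟨xⱼ'', yⱼ''⟩)` for `x, y ∈ 𝕎²`. -/
def innerAlpha (T : Fin p → Set ℝ) (α : Fin p → ℝ) (x y : ProdW2 T) : ℝ :=
  ∑ j, (inner ℝ ((x : ProdL2 T) j) ((y : ProdL2 T) j) +
    α j * inner ℝ (secondDeriv (T j) ⟨(x : ProdL2 T) j, x.2 j⟩)
      (secondDeriv (T j) ⟨(y : ProdL2 T) j, y.2 j⟩))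

/-- `‖x‖_α = ⟨x, x⟩_α^{1/2}`. -/
def normAlpha (T : Fin p → Set ℝ) (α : Fin p → ℝ) (x : ProdW2 T) : ℝ :=
  Real.sqrt (innerAlpha T α x x)

/-- The multivariate half-smoothing operator `diag((I + αⱼ Q)^{-1/2})`. -/
def multiHalfSmoothing (T : Fin p → Set ℝ) (α : Fin p → ℝ) : ProdL2 T →ₗ.[ℝ] ProdL2 T :=
  diagOp fun j => halfSmoothing (T j) (α j)

end

/-!
For a closed densely defined operator `R` and `α > 0`, let `G` be the graph of `√α R` with the norm
of the Hilbert sum, so that the first projection `J : G → E` is an injective contraction whose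
range is the domain of `R`, and the norm of `G` is the energy norm `(‖x‖² + α ‖R x‖²)^{1/2}`.

Von Neumann's theorem takes the form `(I + α R* R)⁻¹ = J J*`
(`inverse_id_add_smul_adjoint_comp`): both sides solve the same variational equation. As `J J*` is
a nonnegative contraction, it has a square root, obtained in a real Hilbert space without
functional calculus from a norm convergent iteration (`exists_isSelfAdjoint_one_sub_mul_self`).
For any self-adjoint square root `B` one has `‖B x‖ = ‖J* x‖`, so polar decomposition gives
`B = J V` with `V` unitary (`exists_linearIsometryEquiv_of_mul_self_eq`). Hence `B` maps the space
isometrically onto the domain of `R` with its energy norm, which is the assertion on the range and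
on the inverse. No uniqueness of the square root is needed, because every square root of `J J*` in
the sense of unbounded operators is everywhere defined and bounded by the Hellinger–Toeplitz
theorem.

For the second derivative on a finite union `T` of intervals, the domain is dense because it
contains the smooth functions. The graph is closed because integrating twice gives a bounded right
inverse (`exists_rightInverse_secondDeriv`), while the kernel consists of functions affine on each
interval and is therefore finite-dimensional (`exists_finiteDimensional_of_isSecondDeriv_zero`).
The product space is treated componentwise through diagonal operators.
-/

/-! ### Square roots in real Banach star algebras -/

/-- If `a` is self-adjoint and `‖a‖ ≤ 1`, then `1 - a` has a self-adjoint square root `1 - b` with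
`‖b‖ ≤ 1`. The element `b` is the limit of the iteration `Y ↦ (a + Y²) / 2` started at `0`; it
converges in norm because its increments are dominated by those of the scalar iteration
`y ↦ (1 + y²) / 2`, which increases and stays below `1`. -/
theorem exists_isSelfAdjoint_one_sub_mul_self {A : Type*} [NormedRing A] [NormedAlgebra ℝ A]
    [CompleteSpace A] [StarRing A] [ContinuousStar A] [StarModule ℝ A] {a : A}
    (ha : IsSelfAdjoint a) (ha1 : ‖a‖ ≤ 1) :
    ∃ b : A, IsSelfAdjoint b ∧ ‖b‖ ≤ 1 ∧ (1 - b) * (1 - b) = 1 - a := by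
  let Y : ℕ → A := fun n => Nat.rec 0 (fun _ Z => (1 / 2 : ℝ) • (a + Z * Z)) n
  let y : ℕ → ℝ := fun n => Nat.rec 0 (fun _ z => (1 / 2 : ℝ) * (1 + z * z)) n
  have Y0 : Y 0 = 0 := rfl
  have y0 : y 0 = 0 := rfl
  have Ys : ∀ n, Y (n + 1) = (1 / 2 : ℝ) • (a + Y n * Y n) := fun n => rfl
  have ys : ∀ n, y (n + 1) = (1 / 2 : ℝ) * (1 + y n * y n) := fun n => rfl
  have hy : ∀ n, 0 ≤ y n ∧ y n ≤ 1 := by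
    intro n
    induction n with
    | zero => simp [y0]
    | succ n ih => rw [ys]; constructor <;> nlinarith [ih.1, ih.2]
  have hcomm : ∀ z : A, Commute a z → ∀ n, Commute (Y n) z := by
    intro z hz n
    induction n with
    | zero => rw [Y0]; exact Commute.zero_left z
    | succ n ih => rw [Ys]; exact (hz.add_left (ih.mul_left ih)).smul_left _
  have hYY : ∀ m n, Commute (Y m) (Y n) := fun m n =>
    hcomm _ (hcomm a (Commute.refl a) n).symm m
  have hsa : ∀ n, IsSelfAdjoint (Y n) := by
    intro n
    induction n with
    | zero => rw [Y0]; exact IsSelfAdjoint.zero A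
    | succ n ih =>
      rw [Ys]
      exact (IsSelfAdjoint.all (1 / 2 : ℝ)).smul (ha.add (by simpa [sq] using ih.pow 2))
  have hnorm : ∀ n, ‖Y n‖ ≤ y n := by
    intro n
    induction n with
    | zero => simp [Y0, y0]
    | succ n ih =>
      rw [Ys, ys, norm_smul, Real.norm_of_nonneg (by norm_num)]
      gcongr
      calc ‖a + Y n * Y n‖ ≤ ‖a‖ + ‖Y n‖ * ‖Y n‖ :=
            (norm_add_le _ _).trans (by gcongr; exact norm_mul_le _ _)
        _ ≤ 1 + y n * y n := by gcongr; exact (hy n).1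
  have hdist : ∀ n, dist (Y n) (Y (n + 1)) ≤ y (n + 1) - y n := by
    intro n
    rw [dist_comm, dist_eq_norm]
    induction n with
    | zero =>
      have h := hnorm 1
      simpa [Y0, y0] using h
    | succ n ih =>
      have e : Y (n + 1 + 1) - Y (n + 1) =
          (1 / 2 : ℝ) • ((Y (n + 1) - Y n) * (Y (n + 1) + Y n)) := by
        rw [Ys (n + 1), Ys n, ← smul_sub, ← Ys n, add_sub_add_left_eq_sub]
        congr 1
        exact (hYY (n + 1) n).mul_self_sub_mul_self_eq'
      have e' : y (n + 1 + 1) - y (n + 1) =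
          (1 / 2 : ℝ) * ((y (n + 1) - y n) * (y (n + 1) + y n)) := by
        rw [ys (n + 1), ys n]; ring
      rw [e, e', norm_smul, Real.norm_of_nonneg (by norm_num)]
      gcongr
      refine (norm_mul_le _ _).trans ?_
      gcongr
      · exact (norm_nonneg _).trans ih
      · exact (norm_add_le _ _).trans (add_le_add (hnorm (n + 1)) (hnorm n))
  have hsum : Summable fun n => y (n + 1) - y n := by
    refine summable_of_sum_range_le (c := 1) (fun n => dist_nonneg.trans (hdist n)) fun n => ?_
    rw [Finset.sum_range_sub, y0, sub_zero]
    exact (hy n).2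
  obtain ⟨b, hb⟩ := cauchySeq_tendsto_of_complete (cauchySeq_of_dist_le_of_summable _ hdist hsum)
  have hfix : b = (1 / 2 : ℝ) • (a + b * b) :=
    tendsto_nhds_unique (hb.comp (Filter.tendsto_add_atTop_nat 1))
      (((hb.mul hb).const_add a).const_smul (1 / 2 : ℝ))
  refine ⟨b, ?_, le_of_tendsto hb.norm (Filter.Eventually.of_forall fun n =>
    (hnorm n).trans (hy n).2), ?_⟩
  · exact tendsto_nhds_unique (hb.star.congr fun n => (hsa n).star_eq) hb
  · have h2 : a + b * b = b + b := by
      conv_rhs => rw [hfix]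
      rw [← add_smul]; norm_num
    have h3 : b * b = b + b - a := eq_sub_of_add_eq' h2
    rw [sub_mul, mul_sub, mul_sub, h3]
    simp only [one_mul, mul_one]
    abel

/-! ### Contractions into a Hilbert space -/

section Contraction

variable {E G : Type*} [NormedAddCommGroup E] [InnerProductSpace ℝ E] [CompleteSpace E]
  [NormedAddCommGroup G] [InnerProductSpace ℝ G] [CompleteSpace G]

open ContinuousLinearMap (adjoint)

/-- `J J*` has a nonnegative self-adjoint square root when `‖J‖ ≤ 1`. -/
theorem exists_sqrt_comp_adjoint (J : G →L[ℝ] E) (hJ : ‖J‖ ≤ 1) :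
    ∃ B : E →L[ℝ] E, IsSelfAdjoint B ∧ (∀ x, 0 ≤ inner ℝ (B x) x) ∧
      B * B = J ∘L adjoint J := by
  set S : E →L[ℝ] E := J ∘L adjoint J with hS
  have hSsa : IsSelfAdjoint S := by
    rw [ContinuousLinearMap.isSelfAdjoint_iff', hS, ContinuousLinearMap.adjoint_comp,
      ContinuousLinearMap.adjoint_adjoint]
  -- `‖S x‖² ≤ ‖J* x‖² = ⟨x, S x⟩`, so `‖x - S x‖² ≤ ‖x‖² - ⟨x, S x⟩`.
  have hle : ‖1 - S‖ ≤ 1 := by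
    refine ContinuousLinearMap.opNorm_le_bound _ zero_le_one fun x => ?_
    rw [one_mul]
    refine le_of_sq_le_sq ?_ (norm_nonneg _)
    have h1 : ‖S x‖ ≤ ‖adjoint J x‖ := by
      exact (J.le_of_opNorm_le hJ (adjoint J x)).trans_eq (one_mul _)
    have h2 : inner ℝ x (S x) = ‖adjoint J x‖ ^ 2 := by
      rw [hS, ContinuousLinearMap.comp_apply, ← ContinuousLinearMap.adjoint_inner_left,
        real_inner_self_eq_norm_sq]
    have h3 : ‖(1 - S) x‖ ^ 2 = ‖x‖ ^ 2 - 2 * inner ℝ x (S x) + ‖S x‖ ^ 2 :=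
      norm_sub_sq_real x (S x)
    rw [h3, h2]
    nlinarith [norm_nonneg (S x), norm_nonneg (adjoint J x)]
  obtain ⟨b, hb, hb1, hbb⟩ := exists_isSelfAdjoint_one_sub_mul_self
    ((IsSelfAdjoint.one (E →L[ℝ] E)).sub hSsa) hle
  refine ⟨1 - b, (IsSelfAdjoint.one _).sub hb, fun x => ?_, by rw [hbb]; abel⟩
  have h1 : inner ℝ (b x) x ≤ ‖x‖ * ‖x‖ :=
    (real_inner_le_norm _ _).trans (by
      gcongr
      simpa using b.le_of_opNorm_le hb1 x)
  have h2 : inner ℝ ((1 - b) x) x = inner ℝ x x - inner ℝ (b x) x := inner_sub_left _ _ _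
  rw [h2, real_inner_self_eq_norm_mul_norm]
  linarith

/-- Polar decomposition: if `J` is injective with dense range and `B` is a self-adjoint square root
of `J J*`, then `B = J V` for a unitary `V`. Indeed `‖B x‖ = ‖J* x‖`, and `V` extends the isometry
`B x ↦ J* x`, which has dense domain and dense range. -/
theorem exists_linearIsometryEquiv_of_mul_self_eq (J : G →L[ℝ] E)
    (hinj : Function.Injective J) (hdense : DenseRange J) {B : E →L[ℝ] E}
    (hB : IsSelfAdjoint B) (hBB : B * B = J ∘L adjoint J) :
    ∃ V : E ≃ₗᵢ[ℝ] G, ∀ x, J (V x) = B x := by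
  have hBB' : ∀ x, B (B x) = J (adjoint J x) := fun x => congrArg (fun C => C x) hBB
  have hsymm : ∀ x y, inner ℝ (B x) y = inner ℝ x (B y) := fun x y => by
    conv_lhs => rw [← hB.adjoint_eq]
    exact ContinuousLinearMap.adjoint_inner_left B y x
  have hnorm : ∀ x, ‖adjoint J x‖ = ‖B x‖ := by
    intro x
    rw [← sq_eq_sq₀ (norm_nonneg _) (norm_nonneg _), ← real_inner_self_eq_norm_sq,
      ← real_inner_self_eq_norm_sq, hsymm, hBB', ContinuousLinearMap.adjoint_inner_left]
  have hJker : LinearMap.ker (adjoint J).toLinearMap = ⊥ := by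
    rw [LinearMap.ker_eq_bot']
    intro x hx
    refine Dense.eq_zero_of_inner_left (𝕜 := ℝ) hdense fun v hv => ?_
    obtain ⟨g, rfl⟩ := hv
    have : inner ℝ (adjoint J x) g = 0 := by
      rw [show adjoint J x = 0 from hx, inner_zero_left]
    rwa [ContinuousLinearMap.adjoint_inner_left] at this
  have hBdense : DenseRange B := by
    have h : (LinearMap.range B.toLinearMap).topologicalClosure = ⊤ := by
      rw [Submodule.topologicalClosure_eq_top_iff, Submodule.eq_bot_iff]
      intro x hx
      have : B x = 0 := by
        refine ext_inner_right ℝ fun y => ?_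
        rw [hsymm, inner_zero_left, real_inner_comm]
        exact (Submodule.mem_orthogonal _ _).1 hx _ ⟨y, rfl⟩
      have h0 : adjoint J x = 0 := by rw [← norm_eq_zero, hnorm, this, norm_zero]
      exact LinearMap.ker_eq_bot'.1 hJker x h0
    exact (Submodule.dense_iff_topologicalClosure_eq_top).2 h
  have hJdense : DenseRange (adjoint J) := by
    have h : (LinearMap.range (adjoint J).toLinearMap).topologicalClosure = ⊤ := by
      rw [Submodule.topologicalClosure_eq_top_iff, Submodule.eq_bot_iff]
      intro g hg
      apply hinj
      rw [map_zero]
      refine ext_inner_left ℝ fun y => ?_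
      rw [← ContinuousLinearMap.adjoint_inner_left, inner_zero_right]
      exact (Submodule.mem_orthogonal _ _).1 hg _ ⟨y, rfl⟩
    exact (Submodule.dense_iff_topologicalClosure_eq_top).2 h
  let V : E ≃ₗᵢ[ℝ] G := (LinearEquiv.refl ℝ E).extendOfIsometry (B : E →ₗ[ℝ] E)
    ((adjoint J : E →L[ℝ] G) : E →ₗ[ℝ] G) hBdense hJdense hnorm
  have hV : ∀ x, V (B x) = adjoint J x := fun x =>
    LinearEquiv.extendOfIsometry_eq (LinearEquiv.refl ℝ E) (B : E →ₗ[ℝ] E)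
      ((adjoint J : E →L[ℝ] G) : E →ₗ[ℝ] G) hBdense hJdense hnorm x
  refine ⟨V, fun x => ?_⟩
  refine congrFun (hBdense.equalizer (J.continuous.comp V.continuous) B.continuous ?_) x
  ext y
  simp [hV, hBB']

end Contraction

/-! ### Unbounded operators -/

section Unbounded

variable {E : Type*} [NormedAddCommGroup E] [InnerProductSpace ℝ E]

open ContinuousLinearMap (adjoint)

theorem mem_graph_opComp_iff (B A : E →ₗ.[ℝ] E) (x z : E) :
    (x, z) ∈ (opComp B A).graph ↔ ∃ y, (x, y) ∈ A.graph ∧ (y, z) ∈ B.graph := by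
  simp only [LinearPMap.mem_graph_iff]
  constructor
  · rintro ⟨⟨x', ⟨w, hw, hwx⟩, hx⟩, rfl, rfl⟩
    obtain rfl : w = ⟨x', hx⟩ := Subtype.ext hwx
    exact ⟨A ⟨x', hx⟩, ⟨⟨x', hx⟩, rfl, rfl⟩, ⟨A ⟨x', hx⟩, hw⟩, rfl, rfl⟩
  · rintro ⟨_, ⟨x', rfl, rfl⟩, y', hy, rfl⟩
    have hw : A x' ∈ B.domain := hy ▸ y'.2
    refine ⟨⟨x', ⟨x', hw, rfl⟩, x'.2⟩, rfl, ?_⟩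
    obtain rfl : y' = ⟨A x', hw⟩ := Subtype.ext hy
    rfl

/-- A partially defined linear map whose graph consists of the pairs `(f x, x)` with `x` running through the whole
space has the everywhere defined inverse `f`. -/
theorem LinearPMap.inverse_eq_toPMap_top {A : E →ₗ.[ℝ] E} {f : E →ₗ[ℝ] E}
    (h : ∀ x y, (x, y) ∈ A.graph ↔ f y = x) : A.inverse = f.toPMap ⊤ := by
  have hker : LinearMap.ker A.toFun = ⊥ := by
    rw [LinearMap.ker_eq_bot']
    intro x hx
    have h1 := (h x (A x)).1 (A.mem_graph x)
    rw [show A x = 0 from hx] at h1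
    exact Subtype.ext (h1.symm.trans f.map_zero)
  refine LinearPMap.eq_of_eq_graph ?_
  rw [LinearPMap.inverse_graph hker]
  ext ⟨y, x⟩
  have h2 : (y, x) ∈ A.graph.map (LinearEquiv.prodComm ℝ E E : (E × E) →ₗ[ℝ] (E × E)) ↔
      (x, y) ∈ A.graph := by
    simp [-LinearPMap.mem_graph_iff]
  rw [h2, h, LinearPMap.mem_graph_iff]
  constructor
  · rintro rfl
    exact ⟨⟨y, trivial⟩, rfl, rfl⟩
  · rintro ⟨y', rfl, rfl⟩
    rfl

/-- The graph of `√α R`, a Hilbert space in which the first coordinate `x` has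
`‖x‖² + α ‖R x‖²` as squared norm. -/
noncomputable def energySpace (R : E →ₗ.[ℝ] E) (α : ℝ) : Submodule ℝ (WithLp 2 (E × E)) :=
  R.graph.comap ((LinearMap.prodMap LinearMap.id ((Real.sqrt α)⁻¹ • LinearMap.id)) ∘ₗ
    (WithLp.linearEquiv 2 ℝ (E × E)).toLinearMap)

/-- The embedding of the energy space of `R` into the ambient Hilbert space, with range the domain
of `R`. -/
noncomputable def energyEmbedding (R : E →ₗ.[ℝ] E) (α : ℝ) : energySpace R α →L[ℝ] E :=
  (WithLp.fstL 2 ℝ E E) ∘L (energySpace R α).subtypeL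

theorem energyEmbedding_apply (R : E →ₗ.[ℝ] E) (α : ℝ) (q : energySpace R α) :
    energyEmbedding R α q = (q : WithLp 2 (E × E)).fst := rfl

theorem mem_energySpace_iff (R : E →ₗ.[ℝ] E) (α : ℝ) (q : WithLp 2 (E × E)) :
    q ∈ energySpace R α ↔ (q.fst, (Real.sqrt α)⁻¹ • q.snd) ∈ R.graph := Iff.rfl

theorem toLp_mem_energySpace (R : E →ₗ.[ℝ] E) {α : ℝ} (hα : 0 < α) (x : R.domain) :
    WithLp.toLp 2 ((x : E), Real.sqrt α • R x) ∈ energySpace R α := by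
  rw [mem_energySpace_iff]
  simp [smul_smul, (Real.sqrt_pos.2 hα).ne']

theorem exists_eq_of_mem_energySpace {R : E →ₗ.[ℝ] E} {α : ℝ} (hα : 0 < α)
    {q : WithLp 2 (E × E)} (hq : q ∈ energySpace R α) :
    ∃ x : R.domain, q = WithLp.toLp 2 ((x : E), Real.sqrt α • R x) := by
  obtain ⟨x, hx, hRx⟩ := (LinearPMap.mem_graph_iff R).1 ((mem_energySpace_iff R α q).1 hq)
  refine ⟨x, ?_⟩
  apply WithLp.ofLp_injective
  refine Prod.ext hx.symm ?_
  simp [hRx, smul_smul, (Real.sqrt_pos.2 hα).ne']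

theorem inner_energySpace (R : E →ₗ.[ℝ] E) {α : ℝ} (hα : 0 < α) (x y : R.domain) :
    inner ℝ (WithLp.toLp 2 ((x : E), Real.sqrt α • R x) : WithLp 2 (E × E))
      (WithLp.toLp 2 ((y : E), Real.sqrt α • R y)) =
    inner ℝ (x : E) (y : E) + α * inner ℝ (R x) (R y) := by
  rw [WithLp.prod_inner_apply]
  simp only [real_inner_smul_left, real_inner_smul_right, ← mul_assoc, Real.mul_self_sqrt hα.le]

theorem isClosed_energySpace {R : E →ₗ.[ℝ] E} (hR : R.IsClosed) (α : ℝ) :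
    IsClosed (energySpace R α : Set (WithLp 2 (E × E))) := by
  have h : Continuous fun q : WithLp 2 (E × E) => (q.fst, (Real.sqrt α)⁻¹ • q.snd) := by fun_prop
  exact hR.preimage h

theorem energyEmbedding_injective {R : E →ₗ.[ℝ] E} {α : ℝ} (hα : 0 < α) :
    Function.Injective (energyEmbedding R α) := by
  rintro ⟨q, hq⟩ ⟨q', hq'⟩ h
  obtain ⟨x, rfl⟩ := exists_eq_of_mem_energySpace hα hq
  obtain ⟨x', rfl⟩ := exists_eq_of_mem_energySpace hα hq'
  obtain rfl : x = x' := Subtype.ext h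
  rfl

theorem range_energyEmbedding {R : E →ₗ.[ℝ] E} {α : ℝ} (hα : 0 < α) :
    Set.range (energyEmbedding R α) = R.domain := by
  ext x
  constructor
  · rintro ⟨⟨q, hq⟩, rfl⟩
    obtain ⟨x, rfl⟩ := exists_eq_of_mem_energySpace hα hq
    exact x.2
  · exact fun hx => ⟨⟨_, toLp_mem_energySpace R hα ⟨x, hx⟩⟩, rfl⟩

theorem norm_energyEmbedding_le (R : E →ₗ.[ℝ] E) (α : ℝ) : ‖energyEmbedding R α‖ ≤ 1 := by
  refine ContinuousLinearMap.opNorm_le_bound _ zero_le_one fun q => ?_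
  rw [one_mul]
  exact WithLp.norm_fst_le E _

variable [CompleteSpace E]

theorem mem_graph_adjoint_iff {R : E →ₗ.[ℝ] E} (hd : Dense (R.domain : Set E)) (y z : E) :
    (y, z) ∈ R.adjoint.graph ↔ ∀ x : R.domain, inner ℝ y (R x) = inner ℝ z (x : E) := by
  rw [LinearPMap.adjoint_graph_eq_graph_adjoint hd, Submodule.mem_adjoint_iff]
  constructor
  · intro h x
    have := h x (R x) (R.mem_graph x)
    rw [real_inner_comm, sub_eq_zero.1 this, real_inner_comm]
  · intro h a b hab
    obtain ⟨x, rfl, rfl⟩ := (LinearPMap.mem_graph_iff R).1 hab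
    rw [real_inner_comm, h x, real_inner_comm, sub_self]

/-- Von Neumann: for closed densely defined `R` and `α > 0` the operator `I + α R* R` has an
everywhere defined bounded inverse, namely `J J*` with `J` the embedding of the energy space. Both
`(I + α R* R) x = y` and `J* y = (x, √α R x)` say that
`⟨x, v⟩ + α ⟨R x, R v⟩ = ⟨y, v⟩` for all `v` in the domain of `R`. -/
theorem inverse_id_add_smul_adjoint_comp {R : E →ₗ.[ℝ] E} (hd : Dense (R.domain : Set E)) {α : ℝ}
    (hα : 0 < α) [CompleteSpace (energySpace R α)] :
    ((LinearMap.id : E →ₗ[ℝ] E) +ᵥ (α • opComp R.adjoint R)).inverse =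
      (energyEmbedding R α ∘L adjoint (energyEmbedding R α)).toLinearMap.toPMap ⊤ := by
  set J := energyEmbedding R α
  have hgraph : ∀ x y, (x, y) ∈ ((LinearMap.id : E →ₗ[ℝ] E) +ᵥ (α • opComp R.adjoint R)).graph ↔
      ∃ z, (x, z) ∈ (opComp R.adjoint R).graph ∧ x + α • z = y := by
    intro x y
    simp only [LinearPMap.mem_graph_iff]
    constructor
    · rintro ⟨x', rfl, rfl⟩
      exact ⟨_, ⟨x', rfl, rfl⟩, rfl⟩
    · rintro ⟨_, ⟨x', rfl, rfl⟩, rfl⟩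
      exact ⟨x', rfl, rfl⟩
  refine LinearPMap.inverse_eq_toPMap_top fun x y => ?_
  rw [hgraph]
  constructor
  · rintro ⟨z, hz, rfl⟩
    obtain ⟨_, hx, hRx⟩ := (mem_graph_opComp_iff _ _ _ _).1 hz
    obtain ⟨x, rfl, rfl⟩ := (LinearPMap.mem_graph_iff R).1 hx
    rw [mem_graph_adjoint_iff hd] at hRx
    have key : adjoint J ((x : E) + α • z) = ⟨_, toLp_mem_energySpace R hα x⟩ := by
      refine ext_inner_right ℝ ?_
      rintro ⟨q, hq⟩
      rw [ContinuousLinearMap.adjoint_inner_left]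
      obtain ⟨v, rfl⟩ := exists_eq_of_mem_energySpace hα hq
      rw [Submodule.coe_inner, inner_energySpace R hα, hRx v, energyEmbedding_apply, inner_add_left,
        real_inner_smul_left]
      rfl
    exact congrArg J key
  · intro h
    obtain ⟨u, hu⟩ := exists_eq_of_mem_energySpace hα (adjoint J y).2
    have hux : (u : E) = x := by
      rw [← h]
      exact congrArg WithLp.fst hu.symm
    have key : ∀ v : R.domain,
        inner ℝ (u : E) (v : E) + α * inner ℝ (R u) (R v) = inner ℝ y (v : E) := by
      intro v
      have := ContinuousLinearMap.adjoint_inner_left J ⟨_, toLp_mem_energySpace R hα v⟩ y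
      rw [Submodule.coe_inner, hu, inner_energySpace R hα] at this
      exact this
    refine ⟨α⁻¹ • (y - x), (mem_graph_opComp_iff _ _ _ _).2 ⟨R u, hux ▸ R.mem_graph u, ?_⟩, ?_⟩
    · rw [mem_graph_adjoint_iff hd]
      intro v
      rw [real_inner_smul_left, inner_sub_left, ← key v, hux]
      field_simp
      ring
    · rw [smul_smul, mul_inv_cancel₀ hα.ne', one_smul, add_sub_cancel]

theorem isPosSqrt_toPMap_top {B S : E →L[ℝ] E} (hB : IsSelfAdjoint B)
    (hpos : ∀ x, 0 ≤ inner ℝ (B x) x) (hBB : B * B = S) :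
    IsPosSqrt (S.toLinearMap.toPMap ⊤) (B.toLinearMap.toPMap ⊤) := by
  refine ⟨?_, fun x => hpos x, ?_⟩
  · rw [LinearPMap.isSelfAdjoint_def,
      ContinuousLinearMap.toPMap_adjoint_eq_adjoint_toPMap_of_dense _ (by simp), hB.adjoint_eq]
  · subst hBB
    refine LinearPMap.eq_of_eq_graph ?_
    ext ⟨x, z⟩
    rw [mem_graph_opComp_iff]
    simp [LinearPMap.mem_graph_iff]

/-- A square root of an everywhere defined operator is everywhere defined, hence bounded
(Hellinger–Toeplitz). -/
theorem IsPosSqrt.exists_continuousLinearMap {S : E →L[ℝ] E} {C : E →ₗ.[ℝ] E}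
    (h : IsPosSqrt (S.toLinearMap.toPMap ⊤) C) :
    ∃ B : E →L[ℝ] E, C = B.toLinearMap.toPMap ⊤ ∧ IsSelfAdjoint B ∧ B * B = S := by
  obtain ⟨hsa, -, hCC⟩ := h
  have hg : ∀ x, ∃ y, (x, y) ∈ C.graph ∧ (y, S x) ∈ C.graph := fun x => by
    rw [← mem_graph_opComp_iff, hCC, LinearPMap.mem_graph_iff]
    exact ⟨⟨x, trivial⟩, rfl, rfl⟩
  have hdom : C.domain = ⊤ := by
    rw [Submodule.eq_top_iff']
    intro x
    obtain ⟨y, hy, -⟩ := hg x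
    exact LinearPMap.mem_domain_of_mem_graph hy
  let f : E →ₗ[ℝ] E := C.toFun ∘ₗ
    LinearMap.codRestrict C.domain LinearMap.id (fun x => hdom ▸ trivial)
  have hf : C = f.toPMap ⊤ := LinearPMap.ext hdom fun _ _ _ => rfl
  have hfs : f.IsSymmetric := by
    intro x y
    have h1 := LinearPMap.adjoint_isFormalAdjoint hsa.dense_domain
    rw [LinearPMap.isSelfAdjoint_def.1 hsa] at h1
    exact h1 ⟨x, hdom ▸ trivial⟩ ⟨y, hdom ▸ trivial⟩
  refine ⟨⟨f, hfs.continuous⟩, hf, ContinuousLinearMap.isSelfAdjoint_iff_isSymmetric.2 hfs, ?_⟩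
  ext x
  obtain ⟨y, hy, hz⟩ := hg x
  rw [hf, LinearPMap.mem_graph_iff] at hy hz
  obtain ⟨x', rfl, rfl⟩ := hy
  obtain ⟨y', h1, h2⟩ := hz
  exact (congrArg f h1.symm).trans h2

theorem isPosSqrt_posSqrt {A : E →ₗ.[ℝ] E} (h : ∃ B, IsPosSqrt A B) : IsPosSqrt A (posSqrt A) := by
  rw [posSqrt, dif_pos h]
  exact h.choose_spec

/-- The square root of `(I + α R* R)⁻¹` exists, and is a bounded operator mapping the space
isometrically onto the domain of `R` with the energy inner product. -/
theorem posSqrt_inverse_id_add_smul_adjoint_comp {R : E →ₗ.[ℝ] E} (hR : R.IsClosed)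
    (hd : Dense (R.domain : Set E)) {α : ℝ} (hα : 0 < α) {A : E →ₗ.[ℝ] E}
    (hA : A = ((LinearMap.id : E →ₗ[ℝ] E) +ᵥ (α • opComp R.adjoint R)).inverse) :
    IsPosSqrt A (posSqrt A) ∧
    ∃ B : E →L[ℝ] E, posSqrt A = B.toLinearMap.toPMap ⊤ ∧ IsSelfAdjoint B ∧
      (∀ x : R.domain, ∃ a, B a = x) ∧
      ∀ a b, ∃ (ha : B a ∈ R.domain) (hb : B b ∈ R.domain),
        inner ℝ a b = inner ℝ (B a) (B b) + α * inner ℝ (R ⟨B a, ha⟩) (R ⟨B b, hb⟩) := by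
  have : CompleteSpace (energySpace R α) := (isClosed_energySpace hR α).completeSpace_coe
  rw [inverse_id_add_smul_adjoint_comp hd hα] at hA
  set J := energyEmbedding R α
  obtain ⟨B₀, h1, h2, h3⟩ := exists_sqrt_comp_adjoint J (norm_energyEmbedding_le R α)
  have hsqrt : IsPosSqrt A (posSqrt A) :=
    isPosSqrt_posSqrt ⟨_, hA ▸ isPosSqrt_toPMap_top h1 h2 h3⟩
  refine ⟨hsqrt, ?_⟩
  have hsqrt' := hsqrt
  nth_rw 1 [hA] at hsqrt'
  obtain ⟨B, hB, hBsa, hBB⟩ := hsqrt'.exists_continuousLinearMap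
  have hrange := range_energyEmbedding (R := R) hα
  obtain ⟨V, hV⟩ := exists_linearIsometryEquiv_of_mul_self_eq J (energyEmbedding_injective hα)
    (by rw [DenseRange, hrange]; exact hd) hBsa hBB
  refine ⟨B, hB, hBsa, fun x => ?_, fun a b => ?_⟩
  · obtain ⟨q, hq⟩ : (x : E) ∈ Set.range J := hrange.ge x.2
    exact ⟨V.symm q, by rw [← hV, V.apply_symm_apply, hq]⟩
  · obtain ⟨x, hx⟩ := exists_eq_of_mem_energySpace hα (V a).2
    obtain ⟨y, hy⟩ := exists_eq_of_mem_energySpace hα (V b).2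
    have hax : B a = x := by
      rw [← hV]
      exact congrArg WithLp.fst hx
    have hby : B b = y := by
      rw [← hV]
      exact congrArg WithLp.fst hy
    have hx' : (⟨B a, hax ▸ x.2⟩ : R.domain) = x := Subtype.ext hax
    have hy' : (⟨B b, hby ▸ y.2⟩ : R.domain) = y := Subtype.ext hby
    refine ⟨hax ▸ x.2, hby ▸ y.2, ?_⟩
    rw [hx', hy', hax, hby, ← inner_energySpace R hα, ← hx, ← hy, ← Submodule.coe_inner,
      V.inner_map_map]

end Unbounded

/-! ### Functions on finite unions of intervals -/

theorem IsIntervalUnion.isCompact {T : Set ℝ} (hT : IsIntervalUnion T) : IsCompact T := by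
  obtain ⟨m, a, b, -, -, rfl⟩ := hT
  exact isCompact_iUnion fun i => isCompact_Icc

theorem IsIntervalUnion.isFiniteMeasure {T : Set ℝ} (hT : IsIntervalUnion T) :
    IsFiniteMeasure ((volume : Measure ℝ).restrict T) :=
  isFiniteMeasure_restrict.2 hT.isCompact.measure_lt_top.ne

theorem Continuous.memLp_restrict_of_isCompact {T : Set ℝ} (hT : IsCompact T) {f : ℝ → ℝ}
    (hf : Continuous f) : MemLp f 2 ((volume : Measure ℝ).restrict T) := by
  have : IsFiniteMeasure ((volume : Measure ℝ).restrict T) :=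
    isFiniteMeasure_restrict.2 hT.measure_lt_top.ne
  obtain ⟨C, hC⟩ := hT.exists_bound_of_continuousOn hf.continuousOn
  exact MemLp.of_bound hf.aestronglyMeasurable C
    ((ae_restrict_mem hT.measurableSet).mono fun t ht => hC t ht)

/-- A function with vanishing derivative almost everywhere is constant on each interval of `T`, if
it is absolutely continuous. -/
theorem AbsContOn.exists_eqOn_const {T : Set ℝ} (hT : MeasurableSet T) {g : ℝ → ℝ}
    (hg : AbsContOn g T) (h0 : ∀ᵐ t ∂(volume.restrict T), HasDerivWithinAt g 0 T t) {a b : ℝ}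
    (hab : a ≤ b) (hsub : Set.Icc a b ⊆ T) : ∃ C, ∀ t ∈ Set.Icc a b, g t = C := by
  rw [← Set.uIcc_of_le hab] at hsub ⊢
  refine (hg a b hsub).const_of_ae_hasDerivAt_zero ?_
  have ha : ∀ᵐ x : ℝ, x ≠ a := by simp [ae_iff, measure_singleton]
  have hb : ∀ᵐ x : ℝ, x ≠ b := by simp [ae_iff, measure_singleton]
  filter_upwards [(ae_restrict_iff' hT).1 h0, ha, hb] with t ht hta htb htm
  refine (ht (hsub htm)).hasDerivAt (Filter.mem_of_superset ?_ hsub)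
  rw [Set.uIcc_of_le hab] at htm ⊢
  exact Icc_mem_nhds (lt_of_le_of_ne htm.1 hta.symm) (lt_of_le_of_ne htm.2 htb)

/-! ### Density of the domain -/

theorem ContDiff.deriv_of_two {g : ℝ → ℝ} (hg : ContDiff ℝ 2 g) : ContDiff ℝ 1 (deriv g) := by
  have h : ContDiff ℝ (1 + 1) g := hg
  exact (contDiff_succ_iff_deriv.1 h).2.2

theorem isSecondDeriv_toLp_of_contDiff {T : Set ℝ} {x : L2 T} {g : ℝ → ℝ}
    (hxg : x =ᵐ[volume.restrict T] g) (hg : ContDiff ℝ 2 g)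
    (h2 : MemLp (deriv (deriv g)) 2 ((volume : Measure ℝ).restrict T)) :
    IsSecondDeriv T x h2.toLp := by
  have hg' := hg.deriv_of_two
  refine ⟨g, deriv g, hxg, fun t _ => ?_, fun a b _ => ?_, fun a b _ => ?_, ?_⟩
  · exact ((hg.differentiable (by norm_num)) t).hasDerivAt.hasDerivWithinAt
  · exact (hg.of_le (by norm_num)).contDiffOn.absolutelyContinuousOnInterval
  · exact hg'.contDiffOn.absolutelyContinuousOnInterval
  · filter_upwards [h2.coeFn_toLp] with t ht
    rw [ht]
    exact ((hg'.differentiable (by norm_num)) t).hasDerivAt.hasDerivWithinAt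

theorem dense_W2 (T : Set ℝ) : Dense (W2 T : Set (L2 T)) := by
  refine (Lp.dense_hasCompactSupport_contDiff (F := ℝ) (p := 2)
    (μ := (volume : Measure ℝ).restrict T) (by simp)).mono ?_
  rintro x ⟨g, hxg, hgc, hg⟩
  have hg2 : ContDiff ℝ 2 g := contDiff_infty.1 hg 2
  exact (mem_W2_iff T x).2 ⟨_, isSecondDeriv_toLp_of_contDiff hxg hg2
    ((hg2.deriv_of_two.continuous_deriv le_rfl).memLp_of_hasCompactSupport hgc.deriv.deriv)⟩

/-! ### Closedness of the second derivative -/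

theorem absContOn_primitive {h : ℝ → ℝ} (hh : ∀ a b, IntervalIntegrable h volume a b)
    (T : Set ℝ) : AbsContOn (fun t => ∫ s in (0 : ℝ)..t, h s) T := by
  intro a b _
  -- Enlarge the interval so that it contains the base point `0`.
  have hle : min 0 (min a b) ≤ max 0 (max a b) := (min_le_left _ _).trans (le_max_left _ _)
  refine ((hh (min 0 (min a b)) (max 0 (max a b))
    ).absolutelyContinuousOnInterval_intervalIntegral (c := 0) ?_).mono ?_
  · rw [Set.uIcc_of_le hle]
    exact ⟨min_le_left _ _, le_max_left _ _⟩
  · rw [Set.uIcc_of_le hle]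
    exact Set.Icc_subset_Icc (min_le_right _ _) (le_max_right _ _)

section DoublePrimitive

variable {T : Set ℝ}

/-- The primitive, vanishing at `0`, of the extension by zero of `y ∈ L²(T)` to the real line. -/
noncomputable def primitive (T : Set ℝ) (y : L2 T) (t : ℝ) : ℝ :=
  ∫ s in (0 : ℝ)..t, T.indicator y s

/-- The primitive, vanishing at `0`, of `primitive T y`. -/
noncomputable def doublePrimitive (T : Set ℝ) (y : L2 T) (t : ℝ) : ℝ :=
  ∫ s in (0 : ℝ)..t, primitive T y s

theorem integrable_indicator_L2 (hT : IsIntervalUnion T) (y : L2 T) :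
    Integrable (T.indicator y) := by
  have := hT.isFiniteMeasure
  rw [integrable_indicator_iff hT.isCompact.measurableSet]
  exact (Lp.memLp y).integrable (by norm_num)

theorem continuous_primitive_L2 (hT : IsIntervalUnion T) (y : L2 T) :
    Continuous (primitive T y) :=
  intervalIntegral.continuous_primitive
    (fun _ _ => (integrable_indicator_L2 hT y).intervalIntegrable) 0

theorem continuous_doublePrimitive (hT : IsIntervalUnion T) (y : L2 T) :
    Continuous (doublePrimitive T y) :=
  intervalIntegral.continuous_primitive
    (fun a b => (continuous_primitive_L2 hT y).intervalIntegrable a b) 0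

theorem primitive_add (hT : IsIntervalUnion T) (y z : L2 T) :
    primitive T (y + z) = primitive T y + primitive T z := by
  funext t
  rw [Pi.add_apply, primitive, primitive, primitive, ← intervalIntegral.integral_add
    (integrable_indicator_L2 hT y).intervalIntegrable
    (integrable_indicator_L2 hT z).intervalIntegrable]
  refine intervalIntegral.integral_congr_ae ?_
  filter_upwards [(ae_restrict_iff' hT.isCompact.measurableSet).1 (Lp.coeFn_add y z)] with s hs _
  by_cases hsT : s ∈ T
  · simpa [hsT] using hs hsT
  · simp [hsT]

theorem primitive_smul (hT : IsIntervalUnion T) (c : ℝ) (y : L2 T) :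
    primitive T (c • y) = c • primitive T y := by
  funext t
  rw [Pi.smul_apply, primitive, primitive, ← intervalIntegral.integral_smul]
  refine intervalIntegral.integral_congr_ae ?_
  filter_upwards [(ae_restrict_iff' hT.isCompact.measurableSet).1 (Lp.coeFn_smul c y)] with s hs _
  by_cases hsT : s ∈ T
  · simpa [hsT] using hs hsT
  · simp [hsT]

theorem doublePrimitive_add (hT : IsIntervalUnion T) (y z : L2 T) :
    doublePrimitive T (y + z) = doublePrimitive T y + doublePrimitive T z := by
  funext t
  rw [Pi.add_apply, doublePrimitive, doublePrimitive, doublePrimitive, primitive_add hT]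
  exact intervalIntegral.integral_add ((continuous_primitive_L2 hT y).intervalIntegrable _ _)
    ((continuous_primitive_L2 hT z).intervalIntegrable _ _)

theorem doublePrimitive_smul (hT : IsIntervalUnion T) (c : ℝ) (y : L2 T) :
    doublePrimitive T (c • y) = c • doublePrimitive T y := by
  funext t
  rw [Pi.smul_apply, doublePrimitive, doublePrimitive, primitive_smul hT]
  exact intervalIntegral.integral_smul c _

theorem norm_primitive_le (hT : IsIntervalUnion T) (y : L2 T) (t : ℝ) :
    ‖primitive T y t‖ ≤ ((volume : Measure ℝ).restrict T).real Set.univ ^ (1 / 2 : ℝ) * ‖y‖ := by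
  have := hT.isFiniteMeasure
  -- The integral over an interval is the inner product with an indicator function.
  have h : ∫ s in Set.uIoc 0 t, T.indicator y s =
      inner ℝ (indicatorConstLp 2 (μ := (volume : Measure ℝ).restrict T)
        (measurableSet_uIoc (a := 0) (b := t)) (measure_ne_top _ _) (1 : ℝ)) y := by
    rw [L2.inner_indicatorConstLp_one, Measure.restrict_restrict measurableSet_uIoc,
      setIntegral_indicator hT.isCompact.measurableSet]
  rw [primitive, intervalIntegral.norm_intervalIntegral_eq, h]
  refine (norm_inner_le_norm _ _).trans ?_
  gcongr
  refine norm_indicatorConstLp_le.trans ?_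
  rw [norm_one, one_mul, ENNReal.toReal_ofNat]
  exact Real.rpow_le_rpow measureReal_nonneg (measureReal_mono (Set.subset_univ _)) (by norm_num)

theorem exists_bound_doublePrimitive (hT : IsIntervalUnion T) :
    ∃ C, 0 ≤ C ∧ ∀ (y : L2 T), ∀ t ∈ T, ‖doublePrimitive T y t‖ ≤ C * ‖y‖ := by
  obtain ⟨M, hM⟩ := hT.isCompact.isBounded.exists_norm_le
  set D := ((volume : Measure ℝ).restrict T).real Set.univ ^ (1 / 2 : ℝ)
  refine ⟨D * |M|, by positivity, fun y t ht => ?_⟩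
  refine (intervalIntegral.norm_integral_le_of_norm_le_const
    fun s _ => norm_primitive_le hT y s).trans ?_
  have h : |t - 0| ≤ |M| := by
    rw [sub_zero]
    exact (hM t ht).trans (le_abs_self M)
  calc D * ‖y‖ * |t - 0| ≤ D * ‖y‖ * |M| := by gcongr
    _ = D * |M| * ‖y‖ := by ring

/-- `doublePrimitive` as a bounded operator in `L²(T)`, a right inverse of the second
derivative. -/
theorem exists_rightInverse_secondDeriv (hT : IsIntervalUnion T) :
    ∃ K : L2 T →L[ℝ] L2 T, ∀ y, IsSecondDeriv T (K y) y := by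
  have := hT.isFiniteMeasure
  have hmem : ∀ y : L2 T, MemLp (doublePrimitive T y) 2 ((volume : Measure ℝ).restrict T) :=
    fun y => (continuous_doublePrimitive hT y).memLp_restrict_of_isCompact hT.isCompact
  obtain ⟨C, hC0, hC⟩ := exists_bound_doublePrimitive hT
  let K₀ : L2 T →ₗ[ℝ] L2 T :=
    { toFun := fun y => (hmem y).toLp
      map_add' := fun y z => by
        rw [← MemLp.toLp_add]
        exact MemLp.toLp_congr _ _ (by rw [doublePrimitive_add hT])
      map_smul' := fun c y => by
        rw [RingHom.id_apply, ← MemLp.toLp_const_smul]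
        exact MemLp.toLp_congr _ _ (by rw [doublePrimitive_smul hT]) }
  let K : L2 T →L[ℝ] L2 T := K₀.mkContinuous _ fun y => by
    have h := Lp.norm_le_of_ae_bound (f := K₀ y) (C := C * ‖y‖) (by positivity) (by
      filter_upwards [(hmem y).coeFn_toLp, ae_restrict_mem hT.isCompact.measurableSet] with t ht htT
      rw [show K₀ y t = _ from ht]
      exact hC y t htT)
    rwa [← mul_assoc] at h
  refine ⟨K, fun y => ⟨doublePrimitive T y, primitive T y, (hmem y).coeFn_toLp, fun t _ => ?_,
    absContOn_primitive (fun a b => (continuous_primitive_L2 hT y).intervalIntegrable a b) T,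
    absContOn_primitive (fun _ _ => (integrable_indicator_L2 hT y).intervalIntegrable) T, ?_⟩⟩
  · exact (intervalIntegral.integral_hasDerivAt_right
      ((continuous_primitive_L2 hT y).intervalIntegrable _ _)
      ((continuous_primitive_L2 hT y).stronglyMeasurableAtFilter _ _)
      (continuous_primitive_L2 hT y).continuousAt).hasDerivWithinAt
  · filter_upwards [ae_restrict_of_ae (s := T)
      (LocallyIntegrable.ae_hasDerivAt_integral
        (integrable_indicator_L2 hT y).locallyIntegrable),
      ae_restrict_mem hT.isCompact.measurableSet] with t ht htT
    have h := ht 0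
    rw [Set.indicator_of_mem htT] at h
    exact h.hasDerivWithinAt

end DoublePrimitive

/-- The functions with vanishing second derivative are affine on each interval of `T`, so they span
a finite-dimensional space. -/
theorem exists_finiteDimensional_of_isSecondDeriv_zero {T : Set ℝ} (hT : IsIntervalUnion T) :
    ∃ N : Submodule ℝ (L2 T), FiniteDimensional ℝ N ∧ ∀ x, IsSecondDeriv T x 0 → x ∈ N := by
  have hTc := hT.isCompact
  obtain ⟨m, a, b, hab, hdisj, hTe⟩ := hT
  have hsub : ∀ i, Set.Icc (a i) (b i) ⊆ T := fun i => by
    rw [hTe]; exact Set.subset_iUnion (fun i => Set.Icc (a i) (b i)) i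
  have hmem : ∀ (h : ℝ → ℝ), Continuous h → ∀ i,
      MemLp ((Set.Icc (a i) (b i)).indicator h) 2 ((volume : Measure ℝ).restrict T) :=
    fun h hh i => (hh.memLp_restrict_of_isCompact hTc).indicator measurableSet_Icc
  let u : Fin m → L2 T := fun i => (hmem (fun _ => 1) continuous_const i).toLp
  let v : Fin m → L2 T := fun i => (hmem id continuous_id i).toLp
  have hu_fin := FiniteDimensional.span_of_finite ℝ (Set.finite_range u)
  have hv_fin := FiniteDimensional.span_of_finite ℝ (Set.finite_range v)
  refine ⟨Submodule.span ℝ (Set.range u) ⊔ Submodule.span ℝ (Set.range v),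
    Submodule.finiteDimensional_sup _ _, ?_⟩
  rintro x ⟨f, g, hxf, hfg, hf, hg, hg0⟩
  have hg1 : ∀ i, ∃ d, ∀ t ∈ Set.Icc (a i) (b i), g t = d := fun i => by
    refine hg.exists_eqOn_const hTc.measurableSet ?_ (hab i).le (hsub i)
    filter_upwards [hg0, Lp.coeFn_zero ℝ 2 (volume.restrict T)] with t ht h0
    rw [h0] at ht
    exact ht
  choose d hd using hg1
  have hf1 : ∀ i, ∃ c, ∀ t ∈ Set.Icc (a i) (b i), f t - d i * t = c := fun i => by
    refine ⟨f (a i) - d i * a i, fun t ht => ?_⟩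
    refine constant_of_has_deriv_right_zero (f := fun t => f t - d i * t) (a := a i) (b := b i)
      ?_ ?_ t ht
    · refine ContinuousOn.sub (fun s hs => ?_) (by fun_prop)
      exact (hfg s (hsub i hs)).continuousWithinAt.mono (hsub i)
    · intro s hs
      have h1 := ((hfg s (hsub i (Set.Ico_subset_Icc_self hs))).mono (hsub i)).sub
        ((hasDerivAt_id s).const_mul (d i)).hasDerivWithinAt
      rw [hd i s (Set.Ico_subset_Icc_self hs), mul_one, sub_self] at h1
      exact h1.mono_of_mem_nhdsWithin (Icc_mem_nhdsGE_of_mem hs)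
  choose c hc using hf1
  have hx : x = ∑ i, c i • u i + ∑ i, d i • v i := by
    refine Lp.ext ?_
    have hu : ∀ᵐ t ∂(volume.restrict T), ∀ i,
        u i t = (Set.Icc (a i) (b i)).indicator (fun _ => (1 : ℝ)) t :=
      ae_all_iff.2 fun i => (hmem (fun _ => 1) continuous_const i).coeFn_toLp
    have hv : ∀ᵐ t ∂(volume.restrict T), ∀ i,
        v i t = (Set.Icc (a i) (b i)).indicator id t :=
      ae_all_iff.2 fun i => (hmem id continuous_id i).coeFn_toLp
    have hcu : ∀ᵐ t ∂(volume.restrict T), ∀ i, (c i • u i : L2 T) t = c i * u i t :=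
      ae_all_iff.2 fun i => Lp.coeFn_smul (c i) (u i)
    have hdv : ∀ᵐ t ∂(volume.restrict T), ∀ i, (d i • v i : L2 T) t = d i * v i t :=
      ae_all_iff.2 fun i => Lp.coeFn_smul (d i) (v i)
    filter_upwards [hxf, hu, hv, hcu, hdv, Lp.coeFn_add (∑ i, c i • u i) (∑ i, d i • v i),
      Lp.coeFn_finsetSum Finset.univ fun i => c i • u i,
      Lp.coeFn_finsetSum Finset.univ fun i => d i • v i,
      ae_restrict_mem hTc.measurableSet] with t h1 h2 h3 h4 h5 h6 h7 h8 ht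
    rw [h1, h6, Pi.add_apply, h7, h8, Finset.sum_apply, Finset.sum_apply,
      ← Finset.sum_add_distrib]
    rw [hTe, Set.mem_iUnion] at ht
    obtain ⟨k, hk⟩ := ht
    rw [Finset.sum_eq_single k]
    · rw [h4, h5, h2, h3, Set.indicator_of_mem hk, Set.indicator_of_mem hk, ← hc k t hk]
      simp
    · intro i _ hik
      have hi : t ∉ Set.Icc (a i) (b i) := fun h => (hdisj hik).le_bot ⟨h, hk⟩
      rw [h4, h5, h2, h3, Set.indicator_of_notMem hi, Set.indicator_of_notMem hi]
      simp
    · simp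
  rw [hx]
  refine Submodule.add_mem_sup (Submodule.sum_mem _ fun i _ => ?_)
    (Submodule.sum_mem _ fun i _ => ?_)
  · exact Submodule.smul_mem _ _ (Submodule.subset_span ⟨i, rfl⟩)
  · exact Submodule.smul_mem _ _ (Submodule.subset_span ⟨i, rfl⟩)

/-- With a bounded right inverse `K` of the second derivative, `(x, y)` is in the graph if and only
if `x - K y` is in the kernel, which is finite-dimensional and therefore closed. -/
theorem secondDeriv_isClosed {T : Set ℝ} (hT : IsIntervalUnion T) : (secondDeriv T).IsClosed := by
  obtain ⟨K, hK⟩ := exists_rightInverse_secondDeriv hT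
  obtain ⟨N, hNfin, hN⟩ := exists_finiteDimensional_of_isSecondDeriv_zero hT
  let ker : Submodule ℝ (L2 T) := (secondDerivGraph T).comap (LinearMap.inl ℝ (L2 T) (L2 T))
  have hker : ∀ x, x ∈ ker ↔ IsSecondDeriv T x 0 := fun x => Iff.rfl
  have : FiniteDimensional ℝ ker :=
    Submodule.finiteDimensional_of_le (fun x hx => hN x ((hker x).1 hx))
  have hgraph : ((secondDeriv T).graph : Set (L2 T × L2 T)) =
      (fun q : L2 T × L2 T => q.1 - K q.2) ⁻¹' (ker : Set (L2 T)) := by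
    ext ⟨x, y⟩
    have hKy : (K y, y) ∈ secondDerivGraph T := hK y
    rw [SetLike.mem_coe, secondDeriv_graph hT, Set.mem_preimage, SetLike.mem_coe, hker]
    constructor
    · intro h
      have h1 := (secondDerivGraph T).sub_mem (show (x, y) ∈ secondDerivGraph T from h) hKy
      rwa [Prod.mk_sub_mk, sub_self] at h1
    · intro h
      have h1 := (secondDerivGraph T).add_mem
        (show (x - K y, (0 : L2 T)) ∈ secondDerivGraph T from h) hKy
      rwa [Prod.mk_add_mk, sub_add_cancel, zero_add] at h1
  rw [LinearPMap.IsClosed, hgraph]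
  exact ker.closed_of_finiteDimensional.preimage (by fun_prop)

/-! ### Diagonal operators -/

section Diagonal

variable {ι : Type*} [Fintype ι] {H : ι → Type*} [∀ j, NormedAddCommGroup (H j)]
  [∀ j, InnerProductSpace ℝ (H j)]

/-- A diagonal operator with self-adjoint contractions as entries is a self-adjoint contraction. -/
theorem exists_diagOp_eq [∀ j, CompleteSpace (H j)] (B : ∀ j, H j →L[ℝ] H j)
    (hB : ∀ j, IsSelfAdjoint (B j)) (hB1 : ∀ j x, ‖B j x‖ ≤ ‖x‖) :
    ∃ L : PiLp 2 H →L[ℝ] PiLp 2 H,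
      diagOp (fun j => (B j).toLinearMap.toPMap ⊤) = L.toLinearMap.toPMap ⊤ ∧
      IsSelfAdjoint L ∧ ‖L‖ ≤ 1 ∧ ∀ x j, L x j = B j (x j) := by
  let L₀ : PiLp 2 H →ₗ[ℝ] PiLp 2 H :=
    { toFun := fun x => WithLp.toLp 2 fun j => B j (x j)
      map_add' := fun x y => by ext j; simp
      map_smul' := fun c x => by ext j; simp }
  have hL₀ : ∀ x, ‖L₀ x‖ ≤ 1 * ‖x‖ := fun x => by
    rw [one_mul, PiLp.norm_eq_of_L2, PiLp.norm_eq_of_L2]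
    refine Real.sqrt_le_sqrt (Finset.sum_le_sum fun j _ => ?_)
    gcongr
    exact hB1 j (x j)
  refine ⟨L₀.mkContinuous 1 hL₀, ?_, ?_, L₀.mkContinuous_norm_le zero_le_one hL₀, fun x j => rfl⟩
  · refine LinearPMap.ext ?_ fun x _ _ => rfl
    ext x
    exact ⟨fun _ => trivial, fun _ _ => trivial⟩
  · rw [ContinuousLinearMap.isSelfAdjoint_iff_isSymmetric]
    intro x y
    rw [PiLp.inner_apply, PiLp.inner_apply]
    exact Finset.sum_congr rfl fun j _ =>
      ContinuousLinearMap.isSelfAdjoint_iff_isSymmetric.1 (hB j) (x j) (y j)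

end Diagonal

/-! ### The half-smoothing operator -/

/-- The half-smoothing operator on one interval union: it maps `L²(T)` isometrically onto `W²(T)`
with the inner product `⟨x, y⟩ + α ⟨x'', y''⟩`. -/
theorem halfSmoothing_spec {T : Set ℝ} (hT : IsIntervalUnion T) {α : ℝ} (hα : 0 < α) :
    IsPosSqrt (smoothing T α) (halfSmoothing T α) ∧
    ∃ B : L2 T →L[ℝ] L2 T, halfSmoothing T α = B.toLinearMap.toPMap ⊤ ∧ IsSelfAdjoint B ∧
      (∀ x : W2 T, ∃ a, B a = x) ∧
      ∀ a b, ∃ (ha : B a ∈ W2 T) (hb : B b ∈ W2 T), inner ℝ a b =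
        inner ℝ (B a) (B b) + α * inner ℝ (secondDeriv T ⟨B a, ha⟩) (secondDeriv T ⟨B b, hb⟩) :=
  posSqrt_inverse_id_add_smul_adjoint_comp (secondDeriv_isClosed hT) (dense_W2 T) hα rfl

theorem lemma1 (p : ℕ) (T : Fin p → Set ℝ) (hT : ∀ j, IsIntervalUnion (T j))
    (α : Fin p → ℝ) (hα : ∀ j, 0 < α j) :
    -- each `(I + αⱼ Q)^{-1/2}` exists
    (∀ j, IsPosSqrt (smoothing (T j) (α j)) (halfSmoothing (T j) (α j))) ∧
    -- it is a bounded everywhere defined self-adjoint operator of norm at most one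
    (∃ L : ProdL2 T →L[ℝ] ProdL2 T,
      multiHalfSmoothing T α = (L : ProdL2 T →ₗ[ℝ] ProdL2 T).toPMap ⊤ ∧
      IsSelfAdjoint L ∧ ‖L‖ ≤ 1) ∧
    -- it is injective with range `𝕎²`, which is the domain of its inverse
    LinearMap.ker (multiHalfSmoothing T α).toFun = ⊥ ∧
    LinearMap.range (multiHalfSmoothing T α).toFun = ProdW2 T ∧
    ∃ hdom : (multiHalfSmoothing T α).inverse.domain = ProdW2 T,
      (∀ x y : ProdW2 T,
        inner ℝ ((multiHalfSmoothing T α).inverse ⟨(x : ProdL2 T), hdom.ge x.2⟩)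
          ((multiHalfSmoothing T α).inverse ⟨(y : ProdL2 T), hdom.ge y.2⟩) =
            innerAlpha T α x y) ∧
      ∀ x : ProdW2 T,
        ‖(multiHalfSmoothing T α).inverse ⟨(x : ProdL2 T), hdom.ge x.2⟩‖ = normAlpha T α x := by
  choose hsqrt B hhalf hBsa hBsurj hBinner using fun j => halfSmoothing_spec (hT j) (hα j)
  have hBnorm : ∀ j a, ‖B j a‖ ≤ ‖a‖ := fun j a => by
    obtain ⟨_, _, h⟩ := hBinner j a a
    refine le_of_sq_le_sq ?_ (norm_nonneg _)
    rw [← real_inner_self_eq_norm_sq, ← real_inner_self_eq_norm_sq, h]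
    exact le_add_of_nonneg_right (mul_nonneg (hα j).le real_inner_self_nonneg)
  have hBinj : ∀ j a, B j a = 0 → a = 0 := fun j a ha => by
    obtain ⟨h1, h2, h⟩ := hBinner j a a
    have h0 : (⟨B j a, h1⟩ : W2 (T j)) = 0 := Subtype.ext ha
    rw [h0, ha, LinearPMap.map_zero, inner_zero_left, mul_zero, add_zero] at h
    exact inner_self_eq_zero.1 h
  obtain ⟨L, hL, hLsa, hL1, hLapply⟩ := exists_diagOp_eq B hBsa hBnorm
  have hM : multiHalfSmoothing T α = L.toLinearMap.toPMap ⊤ := by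
    rw [multiHalfSmoothing, ← hL]
    exact congrArg diagOp (funext hhalf)
  have hker : LinearMap.ker (multiHalfSmoothing T α).toFun = ⊥ := by
    rw [hM, LinearMap.ker_eq_bot']
    intro x hx
    refine Subtype.ext (PiLp.ext fun j => hBinj j _ ?_)
    rw [← hLapply]
    exact congrArg (fun z : ProdL2 T => z j) hx
  have hLW : ∀ a, L a ∈ ProdW2 T := fun a j => by
    rw [hLapply]
    exact (hBinner j (a j) (a j)).1
  have hLsurj : ∀ x : ProdW2 T, ∃ a, L a = x := fun x => by
    choose a ha using fun j => hBsurj j ⟨(x : ProdL2 T) j, x.2 j⟩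
    refine ⟨WithLp.toLp 2 a, PiLp.ext fun j => ?_⟩
    rw [hLapply]
    exact ha j
  have hrange : LinearMap.range (multiHalfSmoothing T α).toFun = ProdW2 T := by
    rw [hM]
    ext x
    constructor
    · rintro ⟨a, rfl⟩
      exact hLW a
    · intro hx
      obtain ⟨a, ha⟩ := hLsurj ⟨x, hx⟩
      exact ⟨⟨a, trivial⟩, ha⟩
  have hdom : (multiHalfSmoothing T α).inverse.domain = ProdW2 T :=
    LinearPMap.inverse_domain.trans hrange
  have hinv : ∀ (x : ProdW2 T) (a : ProdL2 T), L a = x →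
      (multiHalfSmoothing T α).inverse ⟨(x : ProdL2 T), hdom.ge x.2⟩ = a := by
    intro x a ha
    have hadom : a ∈ (multiHalfSmoothing T α).domain := by rw [hM]; trivial
    refine LinearPMap.inverse_apply_eq hker (x := ⟨a, hadom⟩) ?_
    have hg : (a, L a) ∈ (multiHalfSmoothing T α).graph := by
      rw [hM, LinearPMap.mem_graph_iff]
      exact ⟨⟨a, trivial⟩, rfl, rfl⟩
    rw [← ha]
    exact ((LinearPMap.image_iff hadom).2 hg).symm
  have hinner : ∀ x y : ProdW2 T,
      inner ℝ ((multiHalfSmoothing T α).inverse ⟨(x : ProdL2 T), hdom.ge x.2⟩)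
        ((multiHalfSmoothing T α).inverse ⟨(y : ProdL2 T), hdom.ge y.2⟩) =
          innerAlpha T α x y := by
    intro x y
    obtain ⟨a, ha⟩ := hLsurj x
    obtain ⟨b, hb⟩ := hLsurj y
    rw [hinv x a ha, hinv y b hb, PiLp.inner_apply, innerAlpha]
    refine Finset.sum_congr rfl fun j _ => ?_
    have hxj : B j (a j) = (x : ProdL2 T) j := by rw [← hLapply, ha]
    have hyj : B j (b j) = (y : ProdL2 T) j := by rw [← hLapply, hb]
    obtain ⟨h1, h2, h⟩ := hBinner j (a j) (b j)
    simp only [hxj, hyj] at h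
    exact h
  refine ⟨hsqrt, ⟨L, hM, hLsa, hL1⟩, hker, hrange, hdom, hinner, fun x => ?_⟩
  rw [normAlpha, ← hinner x x, real_inner_self_eq_norm_sq, Real.sqrt_sq (norm_nonneg _)]
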